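/- Let $\mathcal X$ be a real separable Hilbert space. Let $T\colon\mathcal X\to\mathcal X$ be a bounded, self-adjoint, non-negative operator ($\langle Tx,x\rangle\ge 0$ for all $x$), and let $k_T(x,y)=\exp(-\tfrac12\|Tx-Ty\|^2)$ be the squared-exponential kernel of $T$, with reproducing kernel Hilbert space $\mathcal H_{k_T}$. Let $N_{a,S}$ be a non-degenerate Gaussian measure on $\mathcal X$, with mean $a\in\mathcal X$ and injective covariance operator $S$. Then $y\mapsto k_T(\cdot,y)\in\mathcal H_{k_T}$ is Bochner integrable with respect to $N_{a,S}$, the operator $TST$ is self-adjoint, non-negative and of trace class, $I+TST$ is boundedly invertible, and the mean embedding $\Phi_{k_T}(N_{a,S})=\int k_T(\cdot,y)\,dN_{a,S}(y)\in\mathcal H_{k_T}$ satisfies, for every $x\in\mathcal X$, $$\Phi_{k_T}(N_{a,S})(x)=\det(I+TST)^{-\frac12}\exp\Bigl(-\tfrac12\bigl\langle (I+TST)^{-1}T(x-a),\,T(x-a)\bigr\rangle\Bigr).$$ Here $\det(I+A)=\prod_n(1+\lambda_n)$ for a self-adjoint trace class operator $A$ with eigenvalues $\lambda_n$ repeated according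 to multiplicity; for $A=TST$ this product converges unconditionally. -/

import Mathlib

open MeasureTheory ProbabilityTheory
open scoped RealInnerProductSpace

noncomputable section

namespace KernelEmbedding

/-! ### Real-valued kernels, their RKHS and the mean embedding -/

section Kernel

variable {X : Type*}

/-- A scalar function `k : X → X → ℝ`, viewed as a matrix of (multiplication) operators on `ℝ`;
this is the form in which Mathlib takes the kernel of a reproducing kernel Hilbert space. -/
def kernelMatrix (k : X → X → ℝ) : Matrix X X (ℝ →L[ℝ] ℝ) :=
  .of fun x y => k x y • ContinuousLinearMap.id ℝ ℝ

/-- `k` is a kernel: it is symmetric, and `∑ᵢⱼ aᵢ aⱼ k(xᵢ, xⱼ) ≥ 0` for all finite families of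
points and real coefficients. -/
def IsKernel (k : X → X → ℝ) : Prop :=
  (∀ x y, k x y = k y x) ∧
    ∀ (s : Finset X) (a : X → ℝ), 0 ≤ ∑ x ∈ s, ∑ y ∈ s, a x * a y * k x y

theorem IsKernel.posSemidef {k : X → X → ℝ} (hk : IsKernel k) : (kernelMatrix k).PosSemidef := by
  have hH : (kernelMatrix k).IsHermitian := by
    ext x y
    simp [kernelMatrix, Matrix.conjTranspose_apply, ContinuousLinearMap.star_eq_adjoint, hk.1 x y,
      ContinuousLinearMap.adjoint_id]
  have h3 : (kernelMatrix k).IsHermitian ∧ ∀ vv : X →₀ ℝ,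
      0 ≤ RCLike.re (vv.sum fun x w => vv.sum fun x' w' => ⟪kernelMatrix k x' x w, w'⟫) := by
    refine ⟨hH, fun vv => ?_⟩
    have h := hk.2 vv.support vv
    simp only [Finsupp.sum, kernelMatrix, Matrix.of_apply, RCLike.re_to_real]
    convert h using 4 with x _ y _
    simp [hk.1 y x]
    ring
  exact (RKHS.posSemidef_tfae.out 0 2).mpr h3

/-- The RKHS `H_k` of the kernel `k`. -/
abbrev Space (k : X → X → ℝ) [Fact (kernelMatrix k).PosSemidef] : Type _ :=
  RKHS.OfKernel (kernelMatrix k)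

/-- The element `k(·, y)` of the RKHS of `k`. -/
def feature (k : X → X → ℝ) [Fact (kernelMatrix k).PosSemidef] (y : X) : Space k :=
  RKHS.kerFun (Space k) y (1 : ℝ)

theorem feature_apply (k : X → X → ℝ) [Fact (kernelMatrix k).PosSemidef] (x y : X) :
    feature k y x = k x y := by
  rw [feature, RKHS.kerFun_apply, RKHS.OfKernel.kernel_ofKernel]
  simp [kernelMatrix]

/-- The mean embedding `Φ_k P = ∫ k(·, y) dP(y)`, a Bochner integral in the RKHS of `k`. -/
def meanEmbedding (k : X → X → ℝ) [Fact (kernelMatrix k).PosSemidef]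
    [MeasurableSpace X] (P : Measure X) : Space k :=
  ∫ y, feature k y ∂P

end Kernel

/-! ### The squared-exponential kernel -/

section SquaredExponential

/-- The squared-exponential kernel `k_T(x, y) = exp (-‖T x - T y‖² / 2)` of a map `T : X → Y`. -/
def seKernel {X Y : Type*} [NormedAddCommGroup Y] (T : X → Y) (x y : X) : ℝ :=
  Real.exp (-(1 / 2) * ‖T x - T y‖ ^ 2)

theorem gaussian_sum_nonneg_of_finiteDimensional {ι E : Type*} [NormedAddCommGroup E]
    [InnerProductSpace ℝ E] [FiniteDimensional ℝ E] (s : Finset ι) (a : ι → ℝ) (v : ι → E) :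
    0 ≤ ∑ i ∈ s, ∑ j ∈ s, a i * a j * Real.exp (-(1 / 2) * ‖v i - v j‖ ^ 2) := by
  let _ : MeasurableSpace E := borel E
  have : BorelSpace E := ⟨rfl⟩
  have hint : ∀ t : E, Integrable (fun g => Real.cos ⟪g, t⟫) (stdGaussian E) := fun t =>
    Integrable.of_bound (by fun_prop) 1 (ae_of_all _ fun g => by
      simpa using Real.abs_cos_le_one _)
  have hcos : ∀ t : E, Real.exp (-(1 / 2) * ‖t‖ ^ 2) = ∫ g, Real.cos ⟪g, t⟫ ∂(stdGaussian E) := by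
    intro t
    have h := charFun_stdGaussian (E := E) t
    rw [charFun_apply] at h
    have h1 := congrArg Complex.re h
    have hi : Integrable (fun g : E => Complex.exp (⟪g, t⟫ * Complex.I)) (stdGaussian E) :=
      Integrable.of_bound (by fun_prop) 1 (ae_of_all _ fun g => by
        simp [Complex.norm_exp_ofReal_mul_I])
    have h2 := integral_re hi
    simp only [RCLike.re_to_complex] at h2
    rw [← h2] at h1
    simp only [Complex.exp_ofReal_mul_I_re] at h1
    rw [h1]
    have : (-(‖t‖ : ℂ) ^ 2 / 2) = (((-(1 / 2) * ‖t‖ ^ 2 : ℝ)) : ℂ) := by push_cast; ring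
    rw [this, Complex.exp_ofReal_re]
  have key : ∑ i ∈ s, ∑ j ∈ s, a i * a j * Real.exp (-(1 / 2) * ‖v i - v j‖ ^ 2)
      = ∫ g, ((∑ i ∈ s, a i * Real.cos ⟪g, v i⟫) ^ 2 + (∑ i ∈ s, a i * Real.sin ⟪g, v i⟫) ^ 2)
        ∂(stdGaussian E) := by
    simp_rw [hcos]
    simp_rw [← integral_const_mul]
    have e1 : ∀ i ∈ s, ∑ j ∈ s, ∫ g, a i * a j * Real.cos ⟪g, v i - v j⟫ ∂(stdGaussian E)
        = ∫ g, ∑ j ∈ s, a i * a j * Real.cos ⟪g, v i - v j⟫ ∂(stdGaussian E) := fun i _ =>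
      (integral_finsetSum _ fun j _ => (hint _).const_mul _).symm
    rw [Finset.sum_congr rfl e1, ← integral_finsetSum _ fun i _ =>
      integrable_finsetSum _ fun j _ => (hint _).const_mul _]
    congr 1
    ext g
    rw [sq, sq, Finset.sum_mul_sum, Finset.sum_mul_sum, ← Finset.sum_add_distrib]
    refine Finset.sum_congr rfl fun i _ => ?_
    rw [← Finset.sum_add_distrib]
    refine Finset.sum_congr rfl fun j _ => ?_
    rw [inner_sub_right, Real.cos_sub]
    ring
  rw [key]
  exact integral_nonneg fun g => by positivity

theorem gaussian_sum_nonneg {ι E : Type*} [NormedAddCommGroup E]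
    [InnerProductSpace ℝ E] (s : Finset ι) (a : ι → ℝ) (v : ι → E) :
    0 ≤ ∑ i ∈ s, ∑ j ∈ s, a i * a j * Real.exp (-(1 / 2) * ‖v i - v j‖ ^ 2) := by
  classical
  let F : Submodule ℝ E := Submodule.span ℝ (s.image v : Set E)
  have h := gaussian_sum_nonneg_of_finiteDimensional s a fun i => F.orthogonalProjectionOnto (v i)
  convert h using 8 with i hi j hj
  have hF : v i - v j ∈ F := F.sub_mem
    (Submodule.subset_span (by simpa using ⟨i, hi, rfl⟩))
    (Submodule.subset_span (by simpa using ⟨j, hj, rfl⟩))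
  have h2 : F.orthogonalProjectionOnto (v i - v j) = ⟨v i - v j, hF⟩ :=
    Submodule.orthogonalProjectionOnto_mem_subspace_eq_self (⟨_, hF⟩ : F)
  rw [← map_sub, h2]
  rfl

theorem isKernel_seKernel {X Y : Type*} [NormedAddCommGroup Y] [InnerProductSpace ℝ Y]
    (T : X → Y) : IsKernel (seKernel T) :=
  ⟨fun x y => by simp [seKernel, norm_sub_rev], fun s a => gaussian_sum_nonneg s a T⟩

instance fact_posSemidef_seKernel {X Y : Type*} [NormedAddCommGroup Y] [InnerProductSpace ℝ Y]
    (T : X → Y) : Fact (kernelMatrix (seKernel T)).PosSemidef :=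
  ⟨(isKernel_seKernel T).posSemidef⟩

end SquaredExponential

/-! ### Gaussian measures, trace class operators, determinants -/

section Operators

variable {X : Type*} [NormedAddCommGroup X] [InnerProductSpace ℝ X]

/-- `P` is the Gaussian measure `N_{a,S}` with mean `a` and covariance operator `S`, that is,
`⟪S u, v⟫` is the covariance of `⟪u, ·⟫` and `⟪v, ·⟫` under `P`. -/
structure IsGaussianMeasure [MeasurableSpace X] [BorelSpace X]
    (P : Measure X) (a : X) (S : X →L[ℝ] X) : Prop where
  isGaussian : IsGaussian P
  mean : ∫ y, y ∂P = a
  covariance : ∀ u v : X, ⟪S u, v⟫ = covarianceBilin P u v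

/-- Non-negative self-adjoint operators of trace class: the trace `∑ ⟪A e, e⟫` is finite in every
orthonormal (Hilbert) basis. Every orthonormal basis is indexed by its own range, a set. -/
def IsPositiveTraceClass (A : X →L[ℝ] X) : Prop :=
  A.IsPositive ∧
    ∀ (w : Set X) (e : HilbertBasis w ℝ X), Summable fun i => ⟪A (e i), e i⟫

/-- The determinant `det (I + A) = ∏ (1 + λₙ)` of `I + A`, for a self-adjoint trace class
operator `A` with eigenvalues `λₙ`, repeated according to multiplicity: the factor `1 + μ` occurs
as often as the dimension of the eigenspace of `μ` says (`μ = 0` contributes the factor `1`). -/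
def detOneAdd (A : X →L[ℝ] X) : ℝ :=
  ∏' μ : ℝ, (1 + μ) ^ Module.finrank ℝ (Module.End.eigenspace (A : X →ₗ[ℝ] X) μ)

end Operators

end KernelEmbedding

end

/-!
The mean embedding evaluated at `x` is the scalar integral `∫ exp (-‖T x - T y‖² / 2) dP(y)`, and
`T S T` is the covariance operator of the Gaussian vector `T y`. Its trace is bounded by the second
moment of `T y`, finite by Fernique's theorem, so `T S T` is Hilbert–Schmidt, hence compact, and has
an orthonormal basis of eigenvectors `e i` with summable eigenvalues `l i ≥ 0`
(`IsPositiveTraceClass.exists_basis_hasProd`).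

In this basis the coordinates `⟪e i, T y⟫` are uncorrelated, jointly Gaussian and therefore
independent, with laws `N(⟪e i, T a⟫, l i)`. For a finite set of indices the integral of
`exp (-∑ ⟪e i, T x - T y⟫² / 2)` thus factors into one-dimensional Gaussian integrals, each equal to
`(1 + l i) ^ (-1/2) * exp (-⟪e i, T (x - a)⟫² / (2 (1 + l i)))`
(`IsGaussianMeasure.integral_exp_finset`). Letting the finite set grow, the left side converges by
dominated convergence, the product of the factors `1 + l i` converges to `det (I + T S T)`, and the
exponent converges to the quadratic form of `(I + T S T)⁻¹`, which is diagonal in the same basis.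
-/

namespace KernelEmbedding

open Filter Topology

/-! ### Positive operators of trace class -/

section Operators

universe u

variable {X : Type*} [NormedAddCommGroup X] [InnerProductSpace ℝ X]

theorem norm_map_sq_le_of_isPositive {A : X →L[ℝ] X} (hA : A.IsPositive) (x : X) :
    ‖A x‖ ^ 2 ≤ ‖A‖ * ⟪A x, x⟫ := by
  rcases (norm_nonneg A).eq_or_lt with h0 | h0
  · simp [norm_eq_zero.1 h0.symm]
  -- positivity of the form at `‖A‖ x - A x`
  have h := hA.inner_nonneg_left (‖A‖ • x - A x)
  have h1 : ⟪A (A x), x⟫ = ‖A x‖ ^ 2 := by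
    rw [hA.inner_left_eq_inner_right, real_inner_self_eq_norm_sq]
  have h2 : ⟪A (A x), A x⟫ ≤ ‖A‖ * ‖A x‖ ^ 2 := by
    calc ⟪A (A x), A x⟫ ≤ ‖A (A x)‖ * ‖A x‖ := real_inner_le_norm _ _
      _ ≤ ‖A‖ * ‖A x‖ * ‖A x‖ := by gcongr; exact A.le_opNorm _
      _ = _ := by ring
  simp only [map_sub, map_smul, inner_sub_left, inner_sub_right, real_inner_smul_left,
    real_inner_smul_right, h1, real_inner_self_eq_norm_sq] at h
  refine le_of_mul_le_mul_left ?_ h0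
  nlinarith

theorem isCompactOperator_rankOne (x y : X) :
    IsCompactOperator (InnerProductSpace.rankOne ℝ x y : X →L[ℝ] X) := by
  rw [InnerProductSpace.rankOne_def']
  exact (isCompactOperator_of_locallyCompactSpace_rng
    (ContinuousLinearMap.toSpanSingleton ℝ x)).comp_clm _

theorem norm_sum_rankOne_sq_le {ι : Type*} {e : ι → X} (he : Orthonormal ℝ e) (v : ι → X)
    (s : Finset ι) :
    ‖∑ i ∈ s, (InnerProductSpace.rankOne ℝ (v i) (e i) : X →L[ℝ] X)‖ ^ 2 ≤
      ∑ i ∈ s, ‖v i‖ ^ 2 := by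
  have hs : 0 ≤ ∑ i ∈ s, ‖v i‖ ^ 2 := by positivity
  refine (Real.le_sqrt (norm_nonneg _) hs).1 ?_
  refine ContinuousLinearMap.opNorm_le_bound _ (Real.sqrt_nonneg _) fun x => ?_
  refine abs_le_of_sq_le_sq' ?_ (by positivity) |>.2
  rw [mul_pow, Real.sq_sqrt hs]
  have hx : ∑ i ∈ s, ‖⟪e i, x⟫‖ ^ 2 ≤ ‖x‖ ^ 2 := he.sum_inner_products_le x
  calc ‖(∑ i ∈ s, (InnerProductSpace.rankOne ℝ (v i) (e i) : X →L[ℝ] X)) x‖ ^ 2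
      ≤ (∑ i ∈ s, ‖v i‖ * ‖⟪e i, x⟫‖) ^ 2 := by
        gcongr
        rw [sum_apply]
        refine (norm_sum_le _ _).trans (Finset.sum_le_sum fun i _ => ?_)
        rw [InnerProductSpace.rankOne_apply, norm_smul, mul_comm]
    _ ≤ (∑ i ∈ s, ‖v i‖ ^ 2) * ∑ i ∈ s, ‖⟪e i, x⟫‖ ^ 2 :=
        Finset.sum_mul_sq_le_sq_mul_sq _ _ _
    _ ≤ _ := by gcongr

theorem countable_of_orthonormal [TopologicalSpace.SeparableSpace X] {ι : Type*} {e : ι → X}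
    (he : Orthonormal ℝ e) : Countable ι := by
  -- the balls of radius `1 / 2` about the `e i` are disjoint, since `‖e i - e j‖ = √2`
  have hd : (Set.univ : Set ι).PairwiseDisjoint fun i => Metric.ball (e i) (1 / 2) := by
    intro i _ j _ hij
    refine Metric.ball_disjoint_ball ?_
    have h : ‖e i - e j‖ ^ 2 = 2 := by
      rw [norm_sub_sq_real, he.1, he.1, he.2 hij]; norm_num
    rw [dist_eq_norm]
    nlinarith [norm_nonneg (e i - e j)]
  exact Set.countable_univ_iff.1 <| hd.countable_of_isOpen (fun _ _ => Metric.isOpen_ball)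
    fun i _ => ⟨e i, Metric.mem_ball_self (by norm_num)⟩

variable [CompleteSpace X]

/-- A Hilbert–Schmidt operator is compact: it is the norm limit of its finite-rank sections. -/
theorem isCompactOperator_of_summable_norm_sq {ι : Type*} (e : HilbertBasis ι ℝ X)
    (A : X →L[ℝ] X) (hA : Summable fun i => ‖A (e i)‖ ^ 2) : IsCompactOperator A := by
  let R : ι → X →L[ℝ] X := fun i => InnerProductSpace.rankOne ℝ (A (e i)) (e i)
  have hR : Summable R := by
    rw [summable_iff_vanishing_norm]
    intro ε hε
    obtain ⟨s, hs⟩ := summable_iff_vanishing_norm.1 hA (ε ^ 2) (by positivity)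
    refine ⟨s, fun t ht => ?_⟩
    have h1 := hs t ht
    rw [Real.norm_of_nonneg (by positivity)] at h1
    exact lt_of_pow_lt_pow_left₀ 2 hε.le
      ((norm_sum_rankOne_sq_le e.orthonormal (fun i => A (e i)) t).trans_lt h1)
  obtain ⟨B, hB⟩ := hR
  have hBA : B = A := by
    ext x
    have h1 : HasSum (fun i => R i x) (B x) :=
      hB.mapL (ContinuousLinearMap.apply ℝ X x)
    have h2 : HasSum (fun i => R i x) (A x) := by
      convert (e.hasSum_repr x).mapL A using 2 with i
      simp [R, e.repr_apply_apply]
    exact h1.unique h2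
  rw [← hBA]
  refine isCompactOperator_of_tendsto hB (Eventually.of_forall fun s => ?_)
  exact (compactOperator (RingHom.id ℝ) X X).sum_mem fun i _ => isCompactOperator_rankOne _ _

theorem IsPositiveTraceClass.isCompactOperator {A : X →L[ℝ] X} (hA : IsPositiveTraceClass A) :
    IsCompactOperator A := by
  obtain ⟨w, e, -⟩ := exists_hilbertBasis ℝ X
  exact isCompactOperator_of_summable_norm_sq e A <|
    ((hA.2 w e).mul_left ‖A‖).of_nonneg_of_le (fun i => by positivity)
      fun i => norm_map_sq_le_of_isPositive hA.1 _

/-- The trace of a positive trace class operator converges along a Hilbert basis with an arbitrary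
index type. -/
theorem IsPositiveTraceClass.summable {A : X →L[ℝ] X} (hA : IsPositiveTraceClass A)
    {ι : Type*} (e : HilbertBasis ι ℝ X) : Summable fun i => ⟪A (e i), e i⟫ := by
  have hinj : Function.Injective e := e.orthonormal.linearIndependent.injective
  have hr : Set.range ((↑) : Set.range e → X) = Set.range e := Subtype.range_coe
  have ho : Orthonormal ℝ ((↑) : Set.range e → X) := e.orthonormal.toSubtypeRange
  have h := hA.2 (Set.range e) (HilbertBasis.mk ho (by rw [hr, e.dense_span]))
  rw [HilbertBasis.coe_mk] at h
  exact (Equiv.ofInjective e hinj).summable_iff.2 h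

theorem isUnit_one_add_of_isPositive {A : X →L[ℝ] X} (hA : A.IsPositive) : IsUnit (1 + A) := by
  refine ContinuousLinearMap.isUnit_of_forall_le_norm_inner_map _ one_pos fun x => ?_
  have h := hA.inner_nonneg_left x
  have h1 : ⟪(1 + A) x, x⟫ = ‖x‖ ^ 2 + ⟪A x, x⟫ := by
    simp [inner_add_left]
  rw [h1, Real.norm_of_nonneg (by positivity)]
  simpa using h

/-- The spectral theorem for a positive trace class operator: an orthonormal basis of
eigenvectors, obtained by joining orthonormal bases of all eigenspaces. The basis vectors of the
eigenspace of `μ` are those with index `⟨μ, i⟩`. -/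
theorem IsPositiveTraceClass.exists_eigenbasis {A : X →L[ℝ] X} (hA : IsPositiveTraceClass A) :
    ∃ (w : ∀ μ : ℝ, Set (Module.End.eigenspace (A : X →ₗ[ℝ] X) μ))
      (b : ∀ μ, HilbertBasis (w μ) ℝ (Module.End.eigenspace (A : X →ₗ[ℝ] X) μ))
      (e : HilbertBasis (Σ μ, w μ) ℝ X), ∀ p : Σ μ, w μ, e p = (b p.1 p.2 : X) := by
  have hsym : (A : X →ₗ[ℝ] X).IsSymmetric := hA.1.isSymmetric
  have hc : ∀ μ, CompleteSpace (Module.End.eigenspace (A : X →ₗ[ℝ] X) μ) := fun μ => by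
    have : IsClosed (Module.End.eigenspace (A : X →ₗ[ℝ] X) μ : Set X) := by
      have : (Module.End.eigenspace (A : X →ₗ[ℝ] X) μ : Set X) = {x | A x = μ • x} := by
        ext x; simp
      rw [this]
      exact isClosed_eq A.continuous (continuous_const_smul μ)
    exact this.completeSpace_coe
  choose w b _ using fun μ => exists_hilbertBasis ℝ (Module.End.eigenspace (A : X →ₗ[ℝ] X) μ)
  have ho := hsym.orthogonalFamily_eigenspaces.orthonormal_sigma_orthonormal
    fun μ => (b μ).orthonormal
  refine ⟨w, b, HilbertBasis.mkOfOrthogonalEqBot ho ?_, fun p => by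
    rw [HilbertBasis.coe_mkOfOrthogonalEqBot]; rfl⟩
  rw [Submodule.eq_bot_iff]
  intro x hx
  have hbot := ContinuousLinearMap.orthogonalComplement_iSup_eigenspaces_eq_bot
    hA.isCompactOperator hA.1.isSymmetric
  rw [← Submodule.mem_bot ℝ, ← hbot, ← Submodule.iInf_orthogonal, Submodule.mem_iInf]
  intro μ
  rw [Submodule.mem_orthogonal]
  intro u hu
  have hs := ((b μ).hasSum_repr ⟨u, hu⟩).mapL
    ((innerSL ℝ x) ∘L (Module.End.eigenspace (A : X →ₗ[ℝ] X) μ).subtypeL)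
  have h0 : ∀ i : w μ, ⟪x, (b μ i : X)⟫ = 0 := fun i => by
    rw [real_inner_comm]
    exact (Submodule.mem_orthogonal _ _).1 hx _ (Submodule.subset_span ⟨⟨μ, i⟩, rfl⟩)
  have hz : ⟪x, u⟫ = 0 := hs.unique (by simp [h0])
  rwa [real_inner_comm]

/-- The determinant over an eigenbasis: the eigenspace of `μ ≠ 0` is finite-dimensional, and its
basis contributes `1 + μ` once per dimension; the one of `0` contributes only factors `1`. -/
theorem IsPositiveTraceClass.exists_basis_hasProd {X : Type u} [NormedAddCommGroup X]
    [InnerProductSpace ℝ X] [CompleteSpace X] {A : X →L[ℝ] X} (hA : IsPositiveTraceClass A) :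
    ∃ (ι : Type u) (e : HilbertBasis ι ℝ X) (l : ι → ℝ),
      (∀ i, 0 ≤ l i) ∧ (∀ i, A (e i) = l i • e i) ∧
      HasProd (fun i => 1 + l i) (detOneAdd A) ∧
      Multipliable fun μ : ℝ =>
        (1 + μ) ^ Module.finrank ℝ (Module.End.eigenspace (A : X →ₗ[ℝ] X) μ) := by
  obtain ⟨w, b, e, he⟩ := hA.exists_eigenbasis
  have hev : ∀ p, A (e p) = p.1 • e p := fun p => by
    rw [he]
    exact Module.End.mem_eigenspace_iff.1 (b p.1 p.2).2
  have hin : ∀ p, ⟪A (e p), e p⟫ = p.1 := fun p => by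
    rw [hev, real_inner_smul_left, real_inner_self_eq_norm_sq, e.orthonormal.1]
    simp
  have hnn : ∀ p : Σ μ, w μ, 0 ≤ p.1 := fun p => hin p ▸ hA.1.inner_nonneg_left _
  have hsum : Summable fun p : Σ μ, w μ => p.1 := by
    simpa only [hin] using hA.summable e
  obtain ⟨d, hd⟩ := Real.multipliable_one_add_of_summable hsum
  have hfib : ∀ μ, HasProd (fun _ : w μ => 1 + μ)
      ((1 + μ) ^ Module.finrank ℝ (Module.End.eigenspace (A : X →ₗ[ℝ] X) μ)) := fun μ => by
    rcases eq_or_ne μ 0 with rfl | hμ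
    · simp
    have hf : Finite (w μ) := by
      have : Summable fun _ : w μ => μ := hsum.comp_injective (sigma_mk_injective (i := μ))
      by_contra hinf
      rw [not_finite_iff_infinite] at hinf
      exact hμ ((summable_const_iff μ).1 this)
    have := Fintype.ofFinite (w μ)
    convert hasProd_fintype (fun _ : w μ => 1 + μ) using 1
    rw [Finset.prod_const, Module.finrank_eq_card_basis (b μ).toOrthonormalBasis.toBasis,
      Finset.card_univ]
  have hprod := hd.sigma hfib
  exact ⟨Σ μ, w μ, e, fun p => p.1, hnn, hev, by rw [detOneAdd, hprod.tprod_eq]; exact hd,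
    hprod.multipliable⟩

theorem hasSum_inner_inverse_one_add {A : X →L[ℝ] X} (hA : A.IsPositive) {ι : Type*}
    (e : HilbertBasis ι ℝ X) {l : ι → ℝ} (hl : ∀ i, 0 ≤ l i) (he : ∀ i, A (e i) = l i • e i)
    (b : X) :
    HasSum (fun i => ⟪e i, b⟫ ^ 2 / (1 + l i)) ⟪Ring.inverse (1 + A) b, b⟫ := by
  set c := Ring.inverse (1 + A) b with hc
  have hcb : (1 + A) c = b := by
    have := Ring.mul_inverse_cancel _ (isUnit_one_add_of_isPositive hA)
    exact congrArg (fun B : X →L[ℝ] X => B b) this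
  have hi : ∀ i, ⟪e i, b⟫ = (1 + l i) * ⟪c, e i⟫ := fun i => by
    rw [← hcb, real_inner_comm (e i)]
    simp only [add_apply, one_apply_eq_self, inner_add_right]
    rw [← hA.inner_left_eq_inner_right, he, real_inner_smul_left]
    ring
  have h := e.hasSum_inner_mul_inner c b
  refine h.congr_fun fun i => ?_
  have : 1 + l i ≠ 0 := by linarith [hl i]
  rw [hi]
  field_simp

end Operators

/-! ### Gaussian integrals -/

section Gaussian

open scoped NNReal

/-- The convolution of `N(m, v)` with an unnormalized standard Gaussian density; the degenerate
case `v = 0`, a Dirac mass, is included. -/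
theorem integral_exp_neg_half_sq_gaussianReal (m c : ℝ) (v : ℝ≥0) :
    ∫ z, Real.exp (-(1 / 2) * (c - z) ^ 2) ∂(gaussianReal m v) =
      (1 + (v : ℝ)) ^ (-(1 / 2) : ℝ) * Real.exp (-(1 / 2) * ((c - m) ^ 2 / (1 + v))) := by
  rcases eq_or_ne v 0 with rfl | hv
  · simp [gaussianReal_zero_var]
  have hv0 : (0 : ℝ) < v := by positivity
  rw [integral_gaussianReal_eq_integral_smul hv]
  -- completing the square
  have h : ∀ z, gaussianPDFReal m v z • Real.exp (-(1 / 2) * (c - z) ^ 2) =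
      ((√(2 * Real.pi * v))⁻¹ * Real.exp (-(1 / 2) * ((c - m) ^ 2 / (1 + v)))) *
        Real.exp (-((1 + v) / (2 * v)) * (z - (m + v * c) / (1 + v)) ^ 2) := fun z => by
    rw [gaussianPDFReal_def, smul_eq_mul, mul_assoc (√_)⁻¹, mul_assoc (√_)⁻¹, ← Real.exp_add,
      ← Real.exp_add]
    congr 2
    field_simp
    ring
  simp_rw [h]
  rw [integral_const_mul,
    integral_sub_right_eq_self (fun z => Real.exp (-((1 + v) / (2 * v)) * z ^ 2)),
    integral_gaussian, mul_right_comm]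
  congr 1
  rw [Real.rpow_neg (by positivity), ← Real.sqrt_eq_rpow, ← Real.sqrt_inv, ← Real.sqrt_inv,
    ← Real.sqrt_mul (by positivity)]
  congr 1
  field_simp

variable {X : Type*} [NormedAddCommGroup X] [InnerProductSpace ℝ X] [CompleteSpace X]
  [TopologicalSpace.SeparableSpace X] [MeasurableSpace X] [BorelSpace X]

theorem IsGaussianMeasure.inner_conj_eq_covariance {P : Measure X} {a : X} {S : X →L[ℝ] X}
    (hP : IsGaussianMeasure P a S) {T : X →L[ℝ] X} (hT : T.IsPositive) (u v : X) :
    ⟪(T * S * T) u, v⟫ = cov[fun y => ⟪u, T y⟫, fun y => ⟪v, T y⟫; P] := by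
  have := UniformSpace.secondCountable_of_separable X
  have := hP.isGaussian
  have h : ⟪(T * S * T) u, v⟫ = ⟪S (T u), T v⟫ := hT.inner_left_eq_inner_right _ _
  rw [h, hP.covariance, covarianceBilin_apply_eq_cov IsGaussian.memLp_two_id]
  simp only [hT.inner_left_eq_inner_right]

theorem IsGaussianMeasure.isPositive_conj {P : Measure X} {a : X} {S : X →L[ℝ] X}
    (hP : IsGaussianMeasure P a S) {T : X →L[ℝ] X} (hT : T.IsPositive) :
    (T * S * T).IsPositive := by
  rw [ContinuousLinearMap.isPositive_iff]
  refine ⟨fun u v => ?_, fun u => ?_⟩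
  · rw [real_inner_comm]
    simp only [ContinuousLinearMap.coe_coe]
    rw [real_inner_comm, hP.inner_conj_eq_covariance hT, covariance_comm,
      ← hP.inner_conj_eq_covariance hT, real_inner_comm]
  · rw [hP.inner_conj_eq_covariance hT, covariance_self]
    · exact variance_nonneg _ _
    · exact (by fun_prop : Continuous fun y => ⟪u, T y⟫).aemeasurable

/-- By Bessel's inequality the partial traces are at most `∫ ‖T y‖² dP(y)`, which is finite by
Fernique's theorem. -/
theorem IsGaussianMeasure.isPositiveTraceClass_conj {P : Measure X} {a : X} {S : X →L[ℝ] X}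
    (hP : IsGaussianMeasure P a S) {T : X →L[ℝ] X} (hT : T.IsPositive) :
    IsPositiveTraceClass (T * S * T) := by
  have := UniformSpace.secondCountable_of_separable X
  have := hP.isGaussian
  have hA := hP.isPositive_conj hT
  refine ⟨hA, fun w e => ?_⟩
  have hT2 : MemLp (fun y => T y) 2 P := T.comp_memLp' IsGaussian.memLp_two_id
  have hm : ∀ i, MemLp (fun y => ⟪(e i : X), T y⟫) 2 P := fun i => hT2.const_inner (e i)
  refine summable_of_sum_le (c := ∫ y, ‖T y‖ ^ 2 ∂P) (fun i => hA.inner_nonneg_left _)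
    fun s => ?_
  calc ∑ i ∈ s, ⟪(T * S * T) (e i), e i⟫
      ≤ ∑ i ∈ s, ∫ y, ⟪(e i : X), T y⟫ ^ 2 ∂P := by
        refine Finset.sum_le_sum fun i _ => ?_
        rw [hP.inner_conj_eq_covariance hT, covariance_self (hm i).aestronglyMeasurable.aemeasurable]
        exact variance_le_expectation_sq (hm i).aestronglyMeasurable
    _ = ∫ y, ∑ i ∈ s, ⟪(e i : X), T y⟫ ^ 2 ∂P :=
        (integral_finsetSum _ fun i _ => (hm i).integrable_sq).symm
    _ ≤ ∫ y, ‖T y‖ ^ 2 ∂P := by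
        refine integral_mono (integrable_finsetSum _ fun i _ => (hm i).integrable_sq)
          hT2.integrable_norm_pow' fun y => ?_
        simpa using e.orthonormal.sum_inner_products_le (T y) (s := s)

/-- Along finitely many eigenvectors of `T S T` the coordinates of `T y` are uncorrelated, hence
independent, and the integral splits into one-dimensional ones. -/
theorem IsGaussianMeasure.integral_exp_finset {P : Measure X} {a : X} {S : X →L[ℝ] X}
    (hP : IsGaussianMeasure P a S) {T : X →L[ℝ] X} (hT : T.IsPositive) {ι : Type*} {e : ι → X}
    (he : Orthonormal ℝ e) {l : ι → ℝ} (hl : ∀ i, 0 ≤ l i)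
    (hev : ∀ i, (T * S * T) (e i) = l i • e i) (x : X) (s : Finset ι) :
    ∫ y, Real.exp (-(1 / 2) * ∑ i ∈ s, ⟪e i, T x - T y⟫ ^ 2) ∂P =
      (∏ i ∈ s, (1 + l i)) ^ (-(1 / 2) : ℝ) *
        Real.exp (-(1 / 2) * ∑ i ∈ s, ⟪e i, T (x - a)⟫ ^ 2 / (1 + l i)) := by
  have := UniformSpace.secondCountable_of_separable X
  have := hP.isGaussian
  classical
  let Z : s → X →L[ℝ] ℝ := fun i => innerSL ℝ (e i) ∘L T
  have hcov : ∀ i j : s, cov[Z i, Z j; P] = if i = j then l i else 0 := fun i j => by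
    have h := hP.inner_conj_eq_covariance hT (e i) (e j)
    rw [hev, real_inner_smul_left, orthonormal_iff_ite.1 he] at h
    refine h.symm.trans ?_
    simp only [Subtype.val_inj, mul_ite, mul_one, mul_zero]
  have hind : iIndepFun (fun i y => Z i y) P :=
    ((IsGaussian.hasGaussianLaw_id (μ := P)).map (ContinuousLinearMap.pi Z)
      ).iIndepFun_of_covariance_eq_zero fun i j hij => by simpa [hij] using hcov i j
  have hmean : ∀ i, ∫ y, Z i y ∂P = ⟪e i, T a⟫ := fun i => by
    have h := (Z i).integral_comp_comm (μ := P) (φ := fun y => y)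
      (IsGaussian.memLp_two_id.integrable (by norm_num))
    rw [h, hP.mean]
    rfl
  have hvar : ∀ i : s, Var[Z i; P] = l i := fun i => by
    rw [← covariance_self (Z i).continuous.aemeasurable, hcov, if_pos rfl]
  have hone : ∀ i : s, ∫ y, Real.exp (-(1 / 2) * (⟪e i, T x⟫ - Z i y) ^ 2) ∂P =
      (1 + l i) ^ (-(1 / 2) : ℝ) *
        Real.exp (-(1 / 2) * (⟪e i, T (x - a)⟫ ^ 2 / (1 + l i))) := fun i => by
    have h := IsGaussian.map_eq_gaussianReal (μ := P) (Z i)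
    rw [hmean, hvar] at h
    have h2 := integral_exp_neg_half_sq_gaussianReal ⟪e i, T a⟫ ⟪(e i : X), T x⟫ (l i).toNNReal
    rw [← h, integral_map (Z i).continuous.aemeasurable
      (by fun_prop : Continuous _).aestronglyMeasurable, Real.coe_toNNReal _ (hl i)] at h2
    rw [h2, map_sub, inner_sub_right]
  calc ∫ y, Real.exp (-(1 / 2) * ∑ i ∈ s, ⟪e i, T x - T y⟫ ^ 2) ∂P
      = ∫ y, ∏ i : s, Real.exp (-(1 / 2) * (⟪e i, T x⟫ - Z i y) ^ 2) ∂P := by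
        congr with y
        rw [← Real.exp_sum, ← Finset.mul_sum, ← Finset.sum_coe_sort s]
        simp [Z, inner_sub_right]
    _ = ∏ i : s, ∫ y, Real.exp (-(1 / 2) * (⟪e i, T x⟫ - Z i y) ^ 2) ∂P :=
        hind.integral_fun_prod_comp
          (f := fun (i : s) z => Real.exp (-(1 / 2) * (⟪(e i : X), T x⟫ - z) ^ 2))
          (fun i => (Z i).continuous.aemeasurable)
          fun i => (by fun_prop : Continuous _).aestronglyMeasurable
    _ = _ := by
        simp_rw [hone]
        rw [Finset.prod_coe_sort s fun i => (1 + l i) ^ (-(1 / 2) : ℝ) *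
          Real.exp (-(1 / 2) * (⟪e i, T (x - a)⟫ ^ 2 / (1 + l i))), Finset.prod_mul_distrib,
          Real.finsetProd_rpow _ _ fun i _ => by linarith [hl i], ← Real.exp_sum,
          ← Finset.mul_sum]

/-- The scalar form of the mean embedding: pass to the limit along the finite sets of eigenvectors
of `T S T`, by dominated convergence on the left (the integrands are at most `1`). -/
theorem IsGaussianMeasure.integral_seKernel {P : Measure X} {a : X} {S : X →L[ℝ] X}
    (hP : IsGaussianMeasure P a S) {T : X →L[ℝ] X} (hT : T.IsPositive) (x : X) :
    ∫ y, seKernel T x y ∂P =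
      detOneAdd (T * S * T) ^ (-(1 / 2) : ℝ) *
        Real.exp (-(1 / 2) * ⟪Ring.inverse (1 + T * S * T) (T (x - a)), T (x - a)⟫) := by
  have := UniformSpace.secondCountable_of_separable X
  have := hP.isGaussian
  have hA := hP.isPositiveTraceClass_conj hT
  obtain ⟨ι, e, l, hl, hev, hprod, -⟩ := hA.exists_basis_hasProd
  have : Countable ι := countable_of_orthonormal e.orthonormal
  have hdet : detOneAdd (T * S * T) ≠ 0 := by
    refine (zero_lt_one.trans_le (ge_of_tendsto hprod (Eventually.of_forall fun s => ?_))).ne'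
    exact Finset.one_le_prod fun i _ => by linarith [hl i]
  have hR := (hprod.rpow_const (p := -(1 / 2)) (Or.inl hdet)).mul
    ((Real.continuous_exp.tendsto _).comp
      ((hasSum_inner_inverse_one_add hA.1 e hl hev (T (x - a))).const_mul (-(1 / 2))))
  have hL : Tendsto (fun s : Finset ι =>
      ∫ y, Real.exp (-(1 / 2) * ∑ i ∈ s, ⟪e i, T x - T y⟫ ^ 2) ∂P) atTop
      (𝓝 (∫ y, seKernel T x y ∂P)) := by
    refine tendsto_integral_filter_of_dominated_convergence (fun _ => 1)
      (Eventually.of_forall fun s => (by fun_prop : Continuous _).aestronglyMeasurable)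
      (Eventually.of_forall fun s => ae_of_all _ fun y => ?_) (integrable_const _)
      (ae_of_all _ fun y => ?_)
    · rw [Real.norm_of_nonneg (Real.exp_pos _).le, Real.exp_le_one_iff]
      have : 0 ≤ ∑ i ∈ s, ⟪e i, T x - T y⟫ ^ 2 := by positivity
      linarith
    · have h := e.hasSum_inner_mul_inner (T x - T y) (T x - T y)
      simp_rw [real_inner_comm (e _) (T x - T y), ← sq, real_inner_self_eq_norm_sq] at h
      exact (Real.continuous_exp.tendsto _).comp (h.const_mul (-(1 / 2)))
  refine tendsto_nhds_unique hL (hR.congr fun s => ?_)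
  rw [hP.integral_exp_finset hT e.orthonormal hl hev]
  simp [Finset.mul_sum]

end Gaussian

/-! ### The feature map of the squared-exponential kernel -/

section Feature

variable {X : Type*}

theorem inner_feature (k : X → X → ℝ) [Fact (kernelMatrix k).PosSemidef] (f : Space k) (y : X) :
    ⟪f, feature k y⟫ = f y := by
  rw [feature, RKHS.inner_kerFun]
  simp

theorem feature_inner (k : X → X → ℝ) [Fact (kernelMatrix k).PosSemidef] (f : Space k) (y : X) :
    ⟪feature k y, f⟫ = f y := by
  rw [real_inner_comm, inner_feature]

theorem norm_feature_seKernel {Y : Type*} [NormedAddCommGroup Y] [InnerProductSpace ℝ Y]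
    (T : X → Y) (y : X) : ‖feature (seKernel T) y‖ = 1 := by
  rw [← sq_eq_sq₀ (norm_nonneg _) zero_le_one, ← real_inner_self_eq_norm_sq, inner_feature,
    feature_apply]
  simp [seKernel]

theorem norm_feature_sub_sq {Y : Type*} [NormedAddCommGroup Y] [InnerProductSpace ℝ Y]
    (T : X → Y) (y z : X) :
    ‖feature (seKernel T) y - feature (seKernel T) z‖ ^ 2 = 2 - 2 * seKernel T z y := by
  rw [norm_sub_sq_real, norm_feature_seKernel, norm_feature_seKernel, inner_feature,
    feature_apply]
  ring

theorem continuous_feature_seKernel [TopologicalSpace X] {Y : Type*} [NormedAddCommGroup Y]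
    [InnerProductSpace ℝ Y] {T : X → Y} (hT : Continuous T) :
    Continuous (feature (seKernel T)) := by
  rw [continuous_iff_continuousAt]
  intro z
  rw [ContinuousAt, tendsto_iff_norm_sub_tendsto_zero]
  have h : Tendsto (fun y => √(2 - 2 * seKernel T z y)) (𝓝 z) (𝓝 0) := by
    have hc : Continuous fun y => √(2 - 2 * seKernel T z y) := by
      unfold seKernel
      fun_prop
    simpa [seKernel] using hc.tendsto z
  refine h.congr fun y => ?_
  rw [← norm_feature_sub_sq, Real.sqrt_sq (norm_nonneg _)]

theorem integrable_feature_seKernel [TopologicalSpace X] [SecondCountableTopology X]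
    [MeasurableSpace X] [OpensMeasurableSpace X] {Y : Type*} [NormedAddCommGroup Y]
    [InnerProductSpace ℝ Y] {T : X → Y} (hT : Continuous T) (P : Measure X) [IsFiniteMeasure P] :
    Integrable (feature (seKernel T)) P :=
  .of_bound (continuous_feature_seKernel hT).aestronglyMeasurable 1
    (ae_of_all _ fun y => (norm_feature_seKernel T y).le)

theorem meanEmbedding_apply {k : X → X → ℝ} [Fact (kernelMatrix k).PosSemidef]
    [MeasurableSpace X] {P : Measure X} (h : Integrable (feature k) P) (x : X) :
    meanEmbedding k P x = ∫ y, k x y ∂P := by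
  rw [← feature_inner, meanEmbedding, ← integral_inner h]
  simp_rw [feature_inner, feature_apply]

end Feature

end KernelEmbedding

theorem theorem5p4 {X : Type*} [NormedAddCommGroup X] [InnerProductSpace ℝ X] [CompleteSpace X]
    [TopologicalSpace.SeparableSpace X] [MeasurableSpace X] [BorelSpace X]
    (T : X →L[ℝ] X) (hT : T.IsPositive)
    (a : X) (S : X →L[ℝ] X) (hS : Function.Injective S)
    (P : Measure X) (hP : KernelEmbedding.IsGaussianMeasure P a S) :
    -- the objects in the formula are well defined
    Integrable (KernelEmbedding.feature (KernelEmbedding.seKernel T)) P ∧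
    KernelEmbedding.IsPositiveTraceClass (T * S * T) ∧
    (Multipliable fun μ : ℝ =>
      (1 + μ) ^ Module.finrank ℝ (Module.End.eigenspace ((T * S * T : X →L[ℝ] X) : X →ₗ[ℝ] X) μ)) ∧
    IsUnit (1 + T * S * T) ∧
    -- the closed form of the mean embedding
    ∀ x : X,
      KernelEmbedding.meanEmbedding (KernelEmbedding.seKernel T) P x =
        KernelEmbedding.detOneAdd (T * S * T) ^ (-(1 / 2) : ℝ) *
          Real.exp (-(1 / 2) * ⟪Ring.inverse (1 + T * S * T) (T (x - a)), T (x - a)⟫) := by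
  have := UniformSpace.secondCountable_of_separable X
  have := hP.isGaussian
  have hA := hP.isPositiveTraceClass_conj hT
  have hint := KernelEmbedding.integrable_feature_seKernel T.continuous P
  obtain ⟨-, -, -, -, -, -, hmul⟩ := hA.exists_basis_hasProd
  exact ⟨hint, hA, hmul, KernelEmbedding.isUnit_one_add_of_isPositive hA.1, fun x =>
    (KernelEmbedding.meanEmbedding_apply hint x).trans (hP.integral_seKernel hT x)⟩
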